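/- Let $G$ be an amenable, locally compact, separable topological group acting continuously on a compact metric space $(X,\upsilon)$, and let $\mu$ be a Borel probability measure on $X$. Suppose that the action is uniquely ergodic for $\mu$ (that is, $\mu$ is the one and only $G$-invariant Borel probability measure on $X$) and non-sensitive on $\operatorname{supp}\mu$, that is, there is no $\beta>0$ such that for all $x\in\operatorname{supp}\mu$ and $\delta>0$ there exist $y\in X$ with $\upsilon(x,y)<\delta$ and $h\in G$ with $\upsilon(hx,hy)\ge\beta$. Let $(\varphi_n)_{n\ge1}$ be a sequence in $G$ that generates a dense subsemigroup of $G$. Let $(p_n)_{n\ge1}$ satisfy $p_n>0$ for all $n$ and $\sum_{n\ge1}p_n=1$. Let $\widetilde{\mathbb N}=\{1,2,\dots\}\cup\{\infty\}$ be the one-point compactification of the discrete space $\{1,2,\dots\}$, let $m$ be the Borel probability measure on $\widetilde{\mathbb N}$ with $m(\{n\})=p_n$ and $m(\{\infty\})=0$, let $Y=\widetilde{\mathbb N}^{\mathbb Z}$ with the product measure $\lambda=\prod_{k\in\mathbb Z}m$, and let $T:Y\to Y$, $(Tr)_k=r_{k+1}$, be the two-sided shift. Put $\varphi_\infty=\mathrm{Id}_X$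 and define $$\Psi:X\times Y\to X\times Y,\qquad \Psi(x,r)=(\varphi_{r_1}(x),\,T(r)).$$ Then $\mu\times\lambda$ is the unique Borel probability measure on $X\times Y$ that is $\Psi$-invariant and absolutely continuous with respect to $\mu\times\lambda$. -/

import Mathlib

open MeasureTheory

noncomputable section

namespace RandomSkewProduct

/-- A topological group is amenable if the bounded continuous real functions on it carry a
left-invariant mean, i.e. a normalized positive linear functional `M` with `M (f (g ·)) = M f`. -/
def IsAmenable (G : Type*) [Group G] [TopologicalSpace G] [IsTopologicalGroup G] : Prop :=
  ∃ M : BoundedContinuousFunction G ℝ →ₗ[ℝ] ℝ,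
    M (BoundedContinuousFunction.const G 1) = 1 ∧
    (∀ f : BoundedContinuousFunction G ℝ, (∀ x, 0 ≤ f x) → 0 ≤ M f) ∧
    ∀ (g : G) (f : BoundedContinuousFunction G ℝ),
      M (f.compContinuous (ContinuousMap.mulLeft g)) = M f

/-- The action of `G` on `X` is uniquely ergodic for `μ`: the measure `μ` is the one and only
`G`-invariant probability measure on `X`. -/
def IsUniquelyErgodicFor (G : Type*) {X : Type*} [Group G] [MulAction G X] [MeasurableSpace X]
    (μ : Measure X) : Prop :=
  ∀ ν : Measure X, (IsProbabilityMeasure ν ∧ SMulInvariantMeasure G X ν) ↔ ν = μ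

/-- The action of `G` on the metric space `X` is sensitive on `A ⊆ X`; the comparison points `y`
range over all of `X`. -/
def IsSensitiveOn (G : Type*) {X : Type*} [Group G] [MulAction G X] [MetricSpace X]
    (A : Set X) : Prop :=
  ∃ β : ℝ, 0 < β ∧ ∀ x ∈ A, ∀ δ : ℝ, 0 < δ →
    ∃ y : X, dist x y < δ ∧ ∃ h : G, β ≤ dist (h • x) (h • y)

/-- The one-point compactification of the discrete space `{1, 2, …}`, with point at infinity. -/
abbrev NTilde : Type := OnePoint ℕ+

instance instMeasurableSpaceNTilde : MeasurableSpace NTilde := borel NTilde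

instance instBorelSpaceNTilde : BorelSpace NTilde := ⟨rfl⟩

/-- The space of two-sided sequences with entries in `NTilde`. -/
abbrev SeqSpace : Type := ℤ → NTilde

/-- The probability measure `m` on `NTilde` with `m {n} = p n` and `m {∞} = 0`. -/
def baseMeasure (p : PMF ℕ+) : Measure NTilde :=
  (p.map (fun n : ℕ+ => (n : NTilde))).toMeasure

instance instIsProbabilityMeasureBaseMeasure (p : PMF ℕ+) :
    IsProbabilityMeasure (baseMeasure p) := by
  unfold baseMeasure; infer_instance

/-- The Bernoulli measure: the product over `ℤ` of copies of `baseMeasure p`. -/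
def bernoulliMeasure (p : PMF ℕ+) : Measure SeqSpace :=
  Measure.infinitePi (fun _ : ℤ => baseMeasure p)

/-- The two-sided shift. -/
def shift (r : SeqSpace) : SeqSpace := fun n => r (n + 1)

/-- The map of `X` attached to a letter: `n ∈ {1, 2, …}` acts as `φ n`, and `∞` as the identity. -/
def letterMap {G X : Type*} [Group G] [MulAction G X] (φ : ℕ+ → G) (a : NTilde) (x : X) : X :=
  OnePoint.elim a x (fun n => φ n • x)

/-- The skew product `Ψ (x, r) = (φ_{r 1} x, T r)`. -/
def skewProduct {G X : Type*} [Group G] [MulAction G X] (φ : ℕ+ → G) (z : X × SeqSpace) :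
    X × SeqSpace :=
  (letterMap φ (z.2 1) z.1, shift z.2)

end RandomSkewProduct

end

namespace RandomSkewProduct

open Set Filter ProbabilityTheory
open scoped ENNReal symmDiff

/-! An invariant probability measure that is absolutely continuous with respect to an ergodic
probability measure equals it, so everything rests on `ergodic_skewProduct`.

Let `E` be invariant and approximate it by a set `C` depending on finitely many coordinates.
Iterating the skew product and its inverse turns `C` into one set determined by the coordinates `≥
1` and another determined by those `≤ 0`, each as close to `E` as `C` is. In each fibre these are
independent, so almost every fibre of `E` is independent of itself and has measure 0 or 1
(`lintegral_section_mul_compl_eq_zero`). Hence `E` is a union of fibres over some `A ⊆ X` up to a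
null set.

Every letter has positive probability, so `A` is almost invariant under each `φ n`. Conditioning `μ`
on `A` gives a `G`-invariant measure by density, and unique ergodicity makes `A` null or conull. -/

instance instCountableNTilde : Countable NTilde :=
  inferInstanceAs (Countable (Option ℕ+))

instance instIsProbabilityMeasureBernoulliMeasure (p : PMF ℕ+) :
    IsProbabilityMeasure (bernoulliMeasure p) := by
  unfold bernoulliMeasure; infer_instance

/-! ### Invariance under a dense subsemigroup -/

section Density

variable {G : Type*} [Group G] [TopologicalSpace G]
  {X : Type*} [MetricSpace X] [CompactSpace X] [MeasurableSpace X] [BorelSpace X]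
  [MulAction G X] [ContinuousSMul G X]

/-- Integrals of continuous functions determine a finite measure, and each such integral varies
continuously with the group element. -/
theorem isClosed_setOf_map_smul_eq (ν : Measure X) [IsFiniteMeasure ν] :
    IsClosed {g : G | ν.map (g • ·) = ν} := by
  have hset : {g : G | ν.map (g • ·) = ν} =
      ⋂ f : BoundedContinuousFunction X ℝ, {g : G | ∫ x, f (g • x) ∂ν = ∫ x, f x ∂ν} := by
    ext g
    have hmap (f : BoundedContinuousFunction X ℝ) :
        ∫ x, f x ∂(ν.map (g • ·)) = ∫ x, f (g • x) ∂ν :=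
      integral_map (continuous_const_smul g).measurable.aemeasurable
        f.continuous.aestronglyMeasurable
    simp only [mem_ofPred_eq, mem_iInter]
    constructor
    · intro h f
      rw [← hmap, h]
    · intro h
      have := Measure.isFiniteMeasure_map ν (fun x : X ↦ g • x)
      exact ext_of_forall_integral_eq_of_IsFiniteMeasure fun f ↦ by rw [hmap, h]
  rw [hset]
  refine isClosed_iInter fun f ↦ isClosed_eq ?_ continuous_const
  -- The translates of `f` vary continuously in sup norm, and integration is continuous in that
  -- norm.
  let F : C(G, C(X, ℝ)) := ContinuousMap.curry
    ⟨fun q : G × X ↦ f (q.1 • q.2), f.continuous.comp continuous_smul⟩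
  have hint : Continuous fun u : C(X, ℝ) ↦ ∫ x, u x ∂ν := by
    have : (fun u : C(X, ℝ) ↦ ∫ x, u x ∂ν) =
        fun u ↦ ∫ x, (ContinuousMap.toLp (E := ℝ) 1 ν ℝ u : X → ℝ) x ∂ν := by
      funext u
      exact integral_congr_ae (ContinuousMap.coeFn_toLp ν u).symm
    rw [this]
    exact continuous_integral.comp (ContinuousMap.toLp (E := ℝ) 1 ν ℝ).continuous
  exact hint.comp F.continuous

theorem smulInvariantMeasure_of_dense_closure {φ : ℕ+ → G}
    (hφ : Dense (Subsemigroup.closure (range φ) : Set G)) (ν : Measure X) [IsFiniteMeasure ν]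
    (h : ∀ n, ν.map (φ n • ·) = ν) : SMulInvariantMeasure G X ν := by
  let S : Subsemigroup G :=
    { carrier := {g : G | ν.map (g • ·) = ν}
      mul_mem' := by
        intro a b (ha : ν.map (a • ·) = ν) (hb : ν.map (b • ·) = ν)
        change ν.map ((a * b) • ·) = ν
        have : (fun x : X ↦ (a * b) • x) = (a • ·) ∘ (b • ·) := by
          funext x; exact mul_smul a b x
        rw [this, ← Measure.map_map (continuous_const_smul a).measurable
          (continuous_const_smul b).measurable, hb, ha] }
  have hS : Subsemigroup.closure (range φ) ≤ S :=
    Subsemigroup.closure_le.2 (range_subset_iff.2 h)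
  have huniv (g : G) : ν.map (g • ·) = ν := by
    have : closure (Subsemigroup.closure (range φ) : Set G) ⊆ {g : G | ν.map (g • ·) = ν} :=
      closure_minimal hS (isClosed_setOf_map_smul_eq ν)
    exact this (hφ g)
  refine ⟨fun g s hs ↦ ?_⟩
  rw [← Measure.map_apply (continuous_const_smul g).measurable hs, huniv]

theorem measure_eq_zero_or_compl_eq_zero {μ : Measure X} (hμ : IsUniquelyErgodicFor G μ)
    {φ : ℕ+ → G} (hφ : Dense (Subsemigroup.closure (range φ) : Set G)) {A : Set X}
    (hA : MeasurableSet A) (h : ∀ n, (φ n • ·) ⁻¹' A =ᵐ[μ] A) : μ A = 0 ∨ μ Aᶜ = 0 := by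
  obtain ⟨hprob, hinv⟩ := (hμ μ).2 rfl
  by_cases h0 : μ A = 0
  · exact Or.inl h0
  right
  have hprob' : IsProbabilityMeasure (μ[|A]) := cond_isProbabilityMeasure h0
  have hmap (n : ℕ+) : (μ[|A]).map (φ n • ·) = μ[|A] := by
    have hm := (continuous_const_smul (T := X) (φ n)).measurable
    -- Trading `A` for its preimage lets the restriction pass through the push-forward.
    rw [ProbabilityTheory.cond, Measure.map_smul, ← Measure.restrict_congr_set (h n),
      ← Measure.restrict_map hm hA, (measurePreserving_smul (φ n) μ).map_eq,
      Measure.restrict_congr_set (h n)]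
  have heq : μ[|A] = μ :=
    (hμ _).1 ⟨hprob', smulInvariantMeasure_of_dense_closure hφ _ hmap⟩
  rw [← heq, cond_apply hA]
  simp

end Density

/-! ### The Bernoulli measure and the shift -/

theorem baseMeasure_singleton (p : PMF ℕ+) (n : ℕ+) :
    baseMeasure p {(n : NTilde)} = p n := by
  rw [baseMeasure, PMF.toMeasure_apply_singleton _ _ (measurableSet_singleton _), PMF.map_apply,
    tsum_eq_single n]
  · simp
  · intro k hk
    rw [if_neg]
    exact fun h ↦ hk (OnePoint.coe_injective h).symm

theorem measurable_shift : Measurable shift :=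
  measurable_pi_lambda _ fun k ↦ measurable_pi_apply (k + 1)

theorem map_shift (p : PMF ℕ+) : (bernoulliMeasure p).map shift = bernoulliMeasure p :=
  Measure.map_infinitePi_infinitePi_of_inj (P := fun _ : ℤ ↦ baseMeasure p)
    (add_left_injective (1 : ℤ))

/-- The coordinates indexed by `S` are kept, all others are replaced by `∞`. -/
noncomputable def keep (S : Set ℤ) (r : SeqSpace) : SeqSpace :=
  open Classical in fun k ↦ if k ∈ S then r k else OnePoint.infty

theorem keep_apply_of_mem {S : Set ℤ} {k : ℤ} (hk : k ∈ S) (r : SeqSpace) : keep S r k = r k :=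
  if_pos hk

/-- A measurable set equal to its preimage under `keep S` therefore lies in the σ-algebra of the
coordinates in `S`, where independence applies. -/
theorem measurable_keep (S : Set ℤ) :
    Measurable[⨆ k ∈ S, MeasurableSpace.comap (fun r : SeqSpace ↦ r k) inferInstance]
      (keep S) := by
  refine @measurable_pi_iff _ _ _ (_) _ _ |>.2 fun k ↦ ?_
  by_cases hk : k ∈ S
  · simp only [keep, if_pos hk]
    exact (comap_measurable (fun r : SeqSpace ↦ r k)).mono
      (le_iSup₂_of_le k hk le_rfl) le_rfl
  · simp only [keep, if_neg hk]
    exact measurable_const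

theorem bernoulliMeasure_inter (p : PMF ℕ+) {S T : Set ℤ} (hST : Disjoint S T)
    {B C : Set SeqSpace} (hB : MeasurableSet B) (hC : MeasurableSet C)
    (hBS : keep S ⁻¹' B = B) (hCT : keep T ⁻¹' C = C) :
    bernoulliMeasure p (B ∩ C) = bernoulliMeasure p B * bernoulliMeasure p C := by
  have hind : iIndepFun (fun (k : ℤ) (r : SeqSpace) ↦ r k) (bernoulliMeasure p) :=
    iIndepFun_infinitePi (P := fun _ : ℤ ↦ baseMeasure p) (X := fun _ a ↦ a)
      fun _ ↦ measurable_id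
  refine (Indep_iff _ _ _).1 (indep_iSup_of_disjoint
    (fun k ↦ (measurable_pi_apply k).comap_le) hind hST) B C ?_ ?_
  · rw [← hBS]; exact measurable_keep S hB
  · rw [← hCT]; exact measurable_keep T hC

/-! ### The skew product -/

section SkewProduct

variable {G : Type*} [Group G] {X : Type*} [MulAction G X]

/-- The inverse of the skew product. -/
def skewProductInv (φ : ℕ+ → G) (z : X × SeqSpace) : X × SeqSpace :=
  (letterMap (fun n ↦ (φ n)⁻¹) (z.2 0) z.1, fun k ↦ z.2 (k - 1))

theorem letterMap_letterMap_inv (φ : ℕ+ → G) (a : NTilde) (x : X) :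
    letterMap φ a (letterMap (fun n ↦ (φ n)⁻¹) a x) = x := by
  induction a using OnePoint.rec with
  | infty => rfl
  | coe n => exact smul_inv_smul _ _

theorem letterMap_inv_letterMap (φ : ℕ+ → G) (a : NTilde) (x : X) :
    letterMap (fun n ↦ (φ n)⁻¹) a (letterMap φ a x) = x := by
  induction a using OnePoint.rec with
  | infty => rfl
  | coe n => exact inv_smul_smul _ _

theorem skewProduct_skewProductInv (φ : ℕ+ → G) (z : X × SeqSpace) :
    skewProduct φ (skewProductInv φ z) = z := by
  refine Prod.ext ?_ ?_
  · simp [skewProduct, skewProductInv, letterMap_letterMap_inv]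
  · funext k; simp [skewProduct, skewProductInv, shift]

theorem skewProductInv_skewProduct (φ : ℕ+ → G) (z : X × SeqSpace) :
    skewProductInv φ (skewProduct φ z) = z := by
  refine Prod.ext ?_ ?_
  · simp [skewProduct, skewProductInv, shift, letterMap_inv_letterMap]
  · funext k; simp [skewProduct, skewProductInv, shift]

/-- Membership in `C` depends only on the first component and on the coordinates in `S`. -/
def DependsOnCoords (S : Set ℤ) (C : Set (X × SeqSpace)) : Prop :=
  ∀ x r r', (∀ k ∈ S, r k = r' k) → ((x, r) ∈ C ↔ (x, r') ∈ C)

theorem DependsOnCoords.mono {S T : Set ℤ} {C : Set (X × SeqSpace)} (h : DependsOnCoords S C)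
    (hST : S ⊆ T) : DependsOnCoords T C :=
  fun x r r' hr ↦ h x r r' fun k hk ↦ hr k (hST hk)

theorem DependsOnCoords.compl {S : Set ℤ} {C : Set (X × SeqSpace)} (h : DependsOnCoords S C) :
    DependsOnCoords S Cᶜ :=
  fun x r r' hr ↦ not_congr (h x r r' hr)

theorem DependsOnCoords.union {S : Set ℤ} {C D : Set (X × SeqSpace)} (hC : DependsOnCoords S C)
    (hD : DependsOnCoords S D) : DependsOnCoords S (C ∪ D) :=
  fun x r r' hr ↦ or_congr (hC x r r' hr) (hD x r r' hr)

theorem DependsOnCoords.keep_preimage {S : Set ℤ} {C : Set (X × SeqSpace)}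
    (h : DependsOnCoords S C) (x : X) :
    keep S ⁻¹' (Prod.mk x ⁻¹' C) = Prod.mk x ⁻¹' C := by
  ext r
  exact h x _ _ fun k hk ↦ keep_apply_of_mem hk r

/-- Each step moves the window up by one and reads only the letter at 1. -/
theorem DependsOnCoords.iterate_skewProduct (φ : ℕ+ → G) (n : ℕ) {C : Set (X × SeqSpace)}
    (h : DependsOnCoords (Ici (1 - n : ℤ)) C) :
    DependsOnCoords (Ici 1) ((skewProduct φ)^[n] ⁻¹' C) := by
  induction n generalizing C with
  | zero => simpa using h
  | succ n ih =>
    rw [Function.iterate_succ', preimage_comp]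
    refine ih fun x r r' hr ↦ ?_
    have h1 : r 1 = r' 1 := hr 1 (by simp)
    simp only [mem_preimage, skewProduct, h1]
    refine h _ _ _ fun k hk ↦ hr (k + 1) ?_
    simp only [mem_Ici] at hk ⊢
    push_cast at hk
    omega

theorem DependsOnCoords.iterate_skewProductInv (φ : ℕ+ → G) (n : ℕ) {C : Set (X × SeqSpace)}
    (h : DependsOnCoords (Iic (n : ℤ)) C) :
    DependsOnCoords (Iic 0) ((skewProductInv φ)^[n] ⁻¹' C) := by
  induction n generalizing C with
  | zero => simpa using h
  | succ n ih =>
    rw [Function.iterate_succ', preimage_comp]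
    refine ih fun x r r' hr ↦ ?_
    have h0 : r 0 = r' 0 := hr 0 (by simp)
    simp only [mem_preimage, skewProductInv, h0]
    refine h _ _ _ fun k hk ↦ hr (k - 1) ?_
    simp only [mem_Iic] at hk ⊢
    push_cast at hk
    omega

/-- Measurable sets depending on finitely many coordinates. -/
def coordAlgebra (X : Type*) [MeasurableSpace X] : Set (Set (X × SeqSpace)) :=
  {C | MeasurableSet C ∧ ∃ n : ℕ, DependsOnCoords (Icc (-n : ℤ) n) C}

theorem isSetAlgebra_coordAlgebra (X : Type*) [MeasurableSpace X] :
    IsSetAlgebra (coordAlgebra X) where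
  empty_mem := ⟨.empty, 0, fun _ _ _ _ ↦ Iff.rfl⟩
  compl_mem := by
    rintro s ⟨hs, n, hn⟩
    exact ⟨hs.compl, n, hn.compl⟩
  union_mem := by
    rintro s t ⟨hs, n, hn⟩ ⟨ht, k, hk⟩
    refine ⟨hs.union ht, max n k, (hn.mono ?_).union (hk.mono ?_)⟩ <;>
    · refine Icc_subset_Icc ?_ ?_ <;> push_cast <;> simp

theorem generateFrom_coordAlgebra (X : Type*) [MeasurableSpace X] :
    (inferInstance : MeasurableSpace (X × SeqSpace)) =
      MeasurableSpace.generateFrom (coordAlgebra X) := by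
  refine le_antisymm ?_ (MeasurableSpace.generateFrom_le fun s hs ↦ hs.1)
  refine sup_le ?_ ?_
  · rintro _ ⟨A, hA, rfl⟩
    exact MeasurableSpace.measurableSet_generateFrom
      ⟨measurable_fst hA, 0, fun _ _ _ _ ↦ Iff.rfl⟩
  · rw [MeasurableSpace.pi, MeasurableSpace.comap_iSup]
    refine iSup_le fun k ↦ ?_
    rw [MeasurableSpace.comap_comp]
    rintro _ ⟨B, hB, rfl⟩
    refine MeasurableSpace.measurableSet_generateFrom
      ⟨((measurable_pi_apply k).comp measurable_snd) hB, k.natAbs, fun x r r' hr ↦ ?_⟩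
    have hk : r k = r' k := hr k ⟨by omega, by omega⟩
    simp [hk]

theorem measurable_letterMap [MeasurableSpace X] [MeasurableConstSMul G X] (φ : ℕ+ → G) :
    Measurable fun z : NTilde × X ↦ letterMap φ z.1 z.2 := by
  refine measurable_from_prod_countable_right fun a ↦ ?_
  induction a using OnePoint.rec with
  | infty => exact measurable_id
  | coe n => exact measurable_const_smul (φ n)

theorem measurable_skewProduct [MeasurableSpace X] [MeasurableConstSMul G X] (φ : ℕ+ → G) :
    Measurable (skewProduct φ : X × SeqSpace → X × SeqSpace) :=
  ((measurable_letterMap φ).comp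
    (((measurable_pi_apply 1).comp measurable_snd).prodMk measurable_fst)).prodMk
    (measurable_shift.comp measurable_snd)

theorem measurable_skewProductInv [MeasurableSpace X] [MeasurableConstSMul G X] (φ : ℕ+ → G) :
    Measurable (skewProductInv φ : X × SeqSpace → X × SeqSpace) :=
  ((measurable_letterMap fun n ↦ (φ n)⁻¹).comp
    (((measurable_pi_apply 0).comp measurable_snd).prodMk measurable_fst)).prodMk
    ((measurable_pi_lambda (fun (r : SeqSpace) k ↦ r (k - 1))
      fun k ↦ measurable_pi_apply (k - 1)).comp measurable_snd)

variable [MeasurableSpace X] [MeasurableConstSMul G X] (μ : Measure X)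
  (φ : ℕ+ → G) (p : PMF ℕ+)

theorem map_letterMap [SMulInvariantMeasure G X μ] (a : NTilde) :
    μ.map (letterMap φ a) = μ := by
  induction a using OnePoint.rec with
  | infty => exact Measure.map_id
  | coe n => exact (measurePreserving_smul (φ n) μ).map_eq

/-- Sections of two sets approximating `E`, one determined by the future and one by the past. -/
theorem lintegral_section_mul_compl_le {E D F : Set (X × SeqSpace)} (hE : MeasurableSet E)
    (hD : MeasurableSet D) (hF : MeasurableSet F) (hDS : DependsOnCoords (Ici 1) D)
    (hFS : DependsOnCoords (Iic 0) F) :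
    ∫⁻ x, bernoulliMeasure p (Prod.mk x ⁻¹' E) * bernoulliMeasure p (Prod.mk x ⁻¹' Eᶜ) ∂μ ≤
      2 * μ.prod (bernoulliMeasure p) (E ∆ D) + 2 * μ.prod (bernoulliMeasure p) (E ∆ F) := by
  have hED := hE.symmDiff hD
  have hEF := hE.symmDiff hF
  rw [Measure.prod_apply hED, Measure.prod_apply hEF,
    ← lintegral_const_mul _ (measurable_measure_prodMk_left hED),
    ← lintegral_const_mul _ (measurable_measure_prodMk_left hEF),
    ← lintegral_add_left ((measurable_measure_prodMk_left hED).const_mul 2)]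
  refine lintegral_mono fun x ↦ ?_
  set ρ := bernoulliMeasure p
  set e := Prod.mk x ⁻¹' E with he
  set d := Prod.mk x ⁻¹' D with hd
  set f := Prod.mk x ⁻¹' F with hf
  have hed : Prod.mk x ⁻¹' (E ∆ D) = e ∆ d := rfl
  have hef : Prod.mk x ⁻¹' (E ∆ F) = e ∆ f := rfl
  have hdisj : Disjoint (Ici (1 : ℤ)) (Iic 0) :=
    Set.disjoint_left.2 fun k hk hk' ↦ by
      simp only [mem_Ici, mem_Iic] at hk hk'
      omega
  have hind : ρ d * ρ fᶜ = ρ (d ∩ fᶜ) :=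
    (bernoulliMeasure_inter p hdisj (measurable_prodMk_left hD)
      (measurable_prodMk_left hF.compl) (hDS.keep_preimage x) (hFS.compl.keep_preimage x)).symm
  have h1 : ρ e ≤ ρ d + ρ (e ∆ d) := by
    refine (measure_mono fun r hr ↦ ?_).trans (measure_union_le _ _)
    by_cases h : r ∈ d
    · exact Or.inl h
    · exact Or.inr (Or.inl ⟨hr, h⟩)
  have h2 : ρ eᶜ ≤ ρ fᶜ + ρ (e ∆ f) := by
    refine (measure_mono fun r hr ↦ ?_).trans (measure_union_le _ _)
    by_cases h : r ∈ f
    · exact Or.inr (Or.inr ⟨h, hr⟩)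
    · exact Or.inl h
  -- A point in `d` but not in `f` must disagree with `e` on one of them.
  have h3 : ρ (d ∩ fᶜ) ≤ ρ (e ∆ d) + ρ (e ∆ f) := by
    refine (measure_mono fun r hr ↦ ?_).trans (measure_union_le _ _)
    by_cases h : r ∈ e
    · exact Or.inr (Or.inl ⟨h, hr.2⟩)
    · exact Or.inl (Or.inr ⟨hr.1, h⟩)
  rw [hed, hef]
  calc ρ e * ρ eᶜ ≤ (ρ d + ρ (e ∆ d)) * ρ eᶜ := by gcongr
    _ = ρ d * ρ eᶜ + ρ (e ∆ d) * ρ eᶜ := add_mul _ _ _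
    _ ≤ ρ d * (ρ fᶜ + ρ (e ∆ f)) + ρ (e ∆ d) * 1 := by gcongr; exact prob_le_one
    _ = ρ (d ∩ fᶜ) + ρ d * ρ (e ∆ f) + ρ (e ∆ d) := by rw [mul_add, hind, mul_one]
    _ ≤ (ρ (e ∆ d) + ρ (e ∆ f)) + 1 * ρ (e ∆ f) + ρ (e ∆ d) := by
        gcongr; exact prob_le_one
    _ = 2 * ρ (e ∆ d) + 2 * ρ (e ∆ f) := by ring

/-! ### Invariant sets of the skew product -/

variable [IsProbabilityMeasure μ]

theorem measurePreserving_skewProduct [SMulInvariantMeasure G X μ] :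
    MeasurePreserving (skewProduct φ) (μ.prod (bernoulliMeasure p))
      (μ.prod (bernoulliMeasure p)) := by
  have h := MeasurePreserving.skew_product (μc := μ) (μd := μ)
    (⟨measurable_shift, map_shift p⟩ :
      MeasurePreserving shift (bernoulliMeasure p) (bernoulliMeasure p))
    (g := fun r x ↦ letterMap φ (r 1) x)
    ((measurable_letterMap φ).comp (f := fun q : SeqSpace × X ↦ (q.1 1, q.2))
      (((measurable_pi_apply 1).comp measurable_fst).prodMk measurable_snd))
    (ae_of_all _ fun r ↦ map_letterMap μ φ (r 1))
  exact (Measure.measurePreserving_swap.comp h).comp Measure.measurePreserving_swap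

theorem measurePreserving_skewProductInv [SMulInvariantMeasure G X μ] :
    MeasurePreserving (skewProductInv φ) (μ.prod (bernoulliMeasure p))
      (μ.prod (bernoulliMeasure p)) := by
  let e : X × SeqSpace ≃ᵐ X × SeqSpace :=
    { toFun := skewProduct φ
      invFun := skewProductInv φ
      left_inv := skewProductInv_skewProduct φ
      right_inv := skewProduct_skewProductInv φ
      measurable_toFun := measurable_skewProduct φ
      measurable_invFun := measurable_skewProductInv φ }
  exact MeasurePreserving.symm e (measurePreserving_skewProduct μ φ p)

theorem lintegral_section_mul_compl_eq_zero [SMulInvariantMeasure G X μ]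
    {E : Set (X × SeqSpace)} (hE : MeasurableSet E) (hinv : skewProduct φ ⁻¹' E = E) :
    ∫⁻ x, bernoulliMeasure p (Prod.mk x ⁻¹' E) * bernoulliMeasure p (Prod.mk x ⁻¹' Eᶜ) ∂μ
      = 0 := by
  have hinv' : skewProductInv φ ⁻¹' E = E := by
    conv_lhs => rw [← hinv]
    ext z
    simp [skewProduct_skewProductInv]
  have hdense : (μ.prod (bernoulliMeasure p)).MeasureDense (coordAlgebra X) :=
    Measure.MeasureDense.of_generateFrom_isSetAlgebra_finite _ (isSetAlgebra_coordAlgebra X)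
      (generateFrom_coordAlgebra X)
  refine nonpos_iff_eq_zero.1 (ENNReal.le_of_forall_pos_le_add fun ε hε _ ↦ ?_)
  obtain ⟨C, ⟨hC, n, hn⟩, hEC⟩ := hdense.approx E hE (measure_ne_top _ _) (ε / 4) (by positivity)
  -- The window `[-n, n]` needs `n + 1` steps to clear 0 upwards, but only `n` to reach `≤ 0`.
  have hΨ := (measurePreserving_skewProduct μ φ p).iterate (n + 1)
  have hΨ' := (measurePreserving_skewProductInv μ φ p).iterate n
  have hD : DependsOnCoords (Ici 1) ((skewProduct φ)^[n + 1] ⁻¹' C) :=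
    .iterate_skewProduct φ (n + 1) (hn.mono fun k hk ↦ by
      simp only [mem_Icc, mem_Ici] at hk ⊢
      push_cast
      omega)
  have hF : DependsOnCoords (Iic 0) ((skewProductInv φ)^[n] ⁻¹' C) :=
    .iterate_skewProductInv φ n (hn.mono fun k hk ↦ hk.2)
  have hED : μ.prod (bernoulliMeasure p) (E ∆ ((skewProduct φ)^[n + 1] ⁻¹' C)) =
      μ.prod (bernoulliMeasure p) (E ∆ C) := by
    rw [← hΨ.measure_preimage (hE.symmDiff hC).nullMeasurableSet, preimage_symmDiff,
      Function.IsFixedPt.preimage_iterate hinv]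
  have hEF : μ.prod (bernoulliMeasure p) (E ∆ ((skewProductInv φ)^[n] ⁻¹' C)) =
      μ.prod (bernoulliMeasure p) (E ∆ C) := by
    rw [← hΨ'.measure_preimage (hE.symmDiff hC).nullMeasurableSet, preimage_symmDiff,
      Function.IsFixedPt.preimage_iterate hinv']
  refine (lintegral_section_mul_compl_le μ p hE (hΨ.measurable hC) (hΨ'.measurable hC)
    hD hF).trans ?_
  rw [hED, hEF, zero_add, ← add_mul]
  refine (mul_le_mul_right hEC.le _).trans ?_
  have h4 : (2 + 2 : ℝ≥0∞) = ENNReal.ofReal 4 := by norm_num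
  rw [h4, ← ENNReal.ofReal_mul (by norm_num), mul_div_cancel₀ _ (by norm_num),
    ENNReal.ofReal_coe_nnreal]

/-- An invariant set of the skew product is almost everywhere a union of fibres. -/
theorem exists_ae_eq_fst_preimage [SMulInvariantMeasure G X μ]
    {E : Set (X × SeqSpace)} (hE : MeasurableSet E) (hinv : skewProduct φ ⁻¹' E = E) :
    ∃ A : Set X, MeasurableSet A ∧ Prod.fst ⁻¹' A =ᵐ[μ.prod (bernoulliMeasure p)] E := by
  have hm := measurable_measure_prodMk_left (ν := bernoulliMeasure p) hE
  have hmc := measurable_measure_prodMk_left (ν := bernoulliMeasure p) hE.compl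
  have hae := (lintegral_eq_zero_iff (hm.mul hmc)).1
    (lintegral_section_mul_compl_eq_zero μ φ p hE hinv)
  -- The base points with full fibre; almost every other fibre is null.
  refine ⟨{x | bernoulliMeasure p (Prod.mk x ⁻¹' Eᶜ) = 0}, hmc (measurableSet_singleton 0), ?_⟩
  have hA : MeasurableSet {x | bernoulliMeasure p (Prod.mk x ⁻¹' Eᶜ) = 0} :=
    hmc (measurableSet_singleton 0)
  rw [← measure_symmDiff_eq_zero_iff, Measure.measure_prod_null
    ((measurable_fst hA).symmDiff hE)]
  filter_upwards [hae] with x hx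
  by_cases hxA : bernoulliMeasure p (Prod.mk x ⁻¹' Eᶜ) = 0
  · refine measure_mono_null (fun r hr ↦ ?_) hxA
    rcases hr with hr | hr
    · exact hr.2
    · exact absurd hxA hr.2
  · have hx0 : bernoulliMeasure p (Prod.mk x ⁻¹' E) = 0 :=
      (mul_eq_zero.1 hx).resolve_right hxA
    refine measure_mono_null (fun r hr ↦ ?_) hx0
    rcases hr with hr | hr
    · exact absurd hr.1 hxA
    · exact hr.1

theorem bernoulliMeasure_setOf_eq (n : ℕ+) :
    bernoulliMeasure p {r | r 1 = (n : NTilde)} = p n := by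
  rw [← baseMeasure_singleton p n]
  exact (measurePreserving_eval_infinitePi (fun _ : ℤ ↦ baseMeasure p) 1).measure_preimage
    (measurableSet_singleton _).nullMeasurableSet

theorem smul_preimage_ae_eq [SMulInvariantMeasure G X μ] (hp : ∀ n, 0 < p n)
    {E : Set (X × SeqSpace)} (hinv : skewProduct φ ⁻¹' E = E) {A : Set X}
    (hAE : Prod.fst ⁻¹' A =ᵐ[μ.prod (bernoulliMeasure p)] E) (n : ℕ+) :
    (φ n • ·) ⁻¹' A =ᵐ[μ] A := by
  have hpre := (measurePreserving_skewProduct μ φ p).quasiMeasurePreserving.preimage_ae_eq hAE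
  rw [hinv] at hpre
  filter_upwards [Measure.ae_ae_of_ae_prod (hpre.trans hAE.symm)] with x hx
  -- Positive probability of the letter `n` forces it to occur among the typical `r` over `x`.
  have hpos : bernoulliMeasure p {r | r 1 = (n : NTilde)} ≠ 0 := by
    rw [bernoulliMeasure_setOf_eq]
    exact (hp n).ne'
  obtain ⟨r, hr, hxr⟩ := ((frequently_ae_iff.2 hpos).and_eventually hx).exists
  have hxr' : (letterMap φ (r 1) x ∈ A) = (x ∈ A) := hxr
  rw [hr] at hxr'
  exact hxr'

end SkewProduct

theorem ergodic_skewProduct {G : Type*} [Group G] [TopologicalSpace G]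
    {X : Type*} [MetricSpace X] [CompactSpace X] [MeasurableSpace X] [BorelSpace X]
    [MulAction G X] [ContinuousSMul G X] {μ : Measure X} (hμ : IsUniquelyErgodicFor G μ)
    {φ : ℕ+ → G} (hφ : Dense (Subsemigroup.closure (range φ) : Set G))
    {p : PMF ℕ+} (hp : ∀ n, 0 < p n) :
    Ergodic (skewProduct φ) (μ.prod (bernoulliMeasure p)) := by
  obtain ⟨hprob, hsmul⟩ := (hμ μ).2 rfl
  refine ⟨measurePreserving_skewProduct μ φ p, ⟨fun E hE hinv ↦ ?_⟩⟩
  obtain ⟨A, hA, hAE⟩ := exists_ae_eq_fst_preimage μ φ p hE hinv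
  rw [eventuallyConst_set']
  rcases measure_eq_zero_or_compl_eq_zero hμ hφ hA
    (smul_preimage_ae_eq μ φ p hp hinv hAE) with h | h
  · left
    refine hAE.symm.trans (ae_eq_empty.2 ?_)
    exact Measure.quasiMeasurePreserving_fst.preimage_null h
  · right
    refine hAE.symm.trans (ae_eq_univ.2 ?_)
    exact Measure.quasiMeasurePreserving_fst.preimage_null h

end RandomSkewProduct

theorem theorem6p1
    {G : Type*} [Group G] [TopologicalSpace G] [IsTopologicalGroup G]
    [LocallyCompactSpace G] [TopologicalSpace.SeparableSpace G]
    (hG : RandomSkewProduct.IsAmenable G)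
    {X : Type*} [MetricSpace X] [CompactSpace X] [MeasurableSpace X] [BorelSpace X]
    [MulAction G X] [ContinuousSMul G X]
    (μ : Measure X)
    (hμ : RandomSkewProduct.IsUniquelyErgodicFor G μ)
    (hsens : ¬ RandomSkewProduct.IsSensitiveOn G μ.support)
    (φ : ℕ+ → G) (hφ : Dense (Subsemigroup.closure (Set.range φ) : Set G))
    (p : PMF ℕ+) (hp : ∀ n, 0 < p n) :
    ∀ τ : Measure (X × RandomSkewProduct.SeqSpace),
      (IsProbabilityMeasure τ ∧
        MeasurePreserving (RandomSkewProduct.skewProduct φ) τ τ ∧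
        τ ≪ μ.prod (RandomSkewProduct.bernoulliMeasure p)) ↔
      τ = μ.prod (RandomSkewProduct.bernoulliMeasure p) := by
  obtain ⟨hprob, hsmul⟩ := (hμ μ).2 rfl
  have herg := RandomSkewProduct.ergodic_skewProduct hμ hφ hp
  refine fun τ ↦ ⟨?_, ?_⟩
  · rintro ⟨_, hτ, hac⟩
    exact herg.eq_of_absolutelyContinuous hτ hac
  · rintro rfl
    exact ⟨inferInstance, herg.toMeasurePreserving, .rfl⟩
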